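/- Let $M$ be $\mathbb R^2$ or a closed connected oriented surface of genus at least one, with a symplectic form $\omega$, let $\varphi$ be a symplectomorphism of $(M,\omega)$ with a hyperbolic fixed point $x$, and suppose that its stable and unstable manifolds $W^s=\{p:\varphi^n(p)\to x,\ n\to\infty\}$ and $W^u=\{p:\varphi^{-n}(p)\to x,\ n\to\infty\}$, which are injectively immersed lines, intersect transversely, and that $\varphi$ preserves the orientations of $W^s$ and $W^u$. For points $p,q$ of $W^i$ ($i\in\{s,u\}$) let $[p,q]_i$ be the segment of $W^i$ between them. A point $p\in W^s\cap W^u$ is called contractible if the loop from $x$ through $[x,p]_u$ to $p$ and back through $[p,x]_s$ is null-homotopic in $M$; let $\mathcal H_{[x]}$ be the set of these points. For $p,q\in\mathcal H_{[x]}$ consider the (contractible) loop from $p$ through $[p,q]_u$ to $q$ and back through $[q,p]_s$, and trivialize $TM$ over a disc bounded by it. Follow the tangent line along the loop, rotating it at $q$ from $T_qW^u$ to $T_qW^s$ by an angle in $(0,\pi)$ and at $p$ from $T_pW^s$ to $T_pW^u$ by an angle in $(-\pi,0)$; the Maslov index $\mu(p,q)\in\mathbb Z$ is the total angle divided by $\pi$,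 and $\mu(p):=\mu(p,x)$. Let $D\subset\mathbb R^2$ be a di-gon, i.e. a lens with two convex vertices at $(-1,0)$ and $(1,0)$. Orient $W^u$. If $\mu(p)-\mu(q)=1$, then $n(p,q):=0$ if there is no smooth orientation preserving immersion $D\to M$ that maps $(-1,0)$ to $p$, $(1,0)$ to $q$, the lower boundary into $W^u$ and the upper boundary into $W^s$; otherwise $n(p,q):=+1$ if the direction from $p$ to $q$ along $[p,q]_u$ agrees with the orientation of $W^u$, and $n(p,q):=-1$ if not. For a finite set $E\subset\mathcal H_{[x]}$ let $\mathbb ZE$ be the free $\mathbb Z$-module generated by $E$ and $\partial^E:\mathbb ZE\to\mathbb ZE$ the linear map with $\partial^Ep=\sum_{q\in E,\ \mu(q)=\mu(p)-1}n(p,q)\,q$ for $p\in E$. Let $\overline{\mathcal E}$ be the set of all finite $E\subset\mathcal H_{[x]}$ with $\partial^E\circ\partial^E=0$ (this does not depend on the orientation of $W^u$), ordered by inclusion, and for $D\subseteq E$ let $\mathcal I^{DE}:\mathbb ZD\to\mathbb ZE$ be the map induced by the inclusion. For a system $(A^i,\alpha^{ij})$ of modules indexed by a partially ordered set $I$ let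 $\lambda^i:A^i\to\bigoplus_iA^i$ be the insertions, $S$ the submodule generated by all $\lambda^j(\alpha^{ij}(c))-\lambda^i(c)$ with $i\preceq j$, $c\in A^i$, and $\varinjlim A^i:=(\bigoplus_iA^i)/S$. Then the following holds. 1. $(\mathbb ZE,\mathcal I^{DE})$ with index set $\overline{\mathcal E}$ is a direct system of $\mathbb Z$-modules, in particular of abelian groups: $\mathcal I^{EE}=\mathrm{Id}$ and $\mathcal I^{EF}\circ\mathcal I^{DE}=\mathcal I^{DF}$ for $D\subseteq E\subseteq F$. Its direct limit in the category of $\mathbb Z$-modules exists: $\varinjlim\mathbb ZE$ with the maps $c\mapsto\lambda^E(c)+S$ has the universal property of the direct limit. 2. Let $\tilde{\mathcal E}\subset\overline{\mathcal E}$ be directed (any two elements of $\tilde{\mathcal E}$ have a common upper bound in $\tilde{\mathcal E}$). Then $(\mathbb ZE,\mathcal I^{DE})$ with index set $\tilde{\mathcal E}$ is a direct system of $\mathbb Z$-modules, in particular of abelian groups, with direct limit $\varinjlim\mathbb ZE$ as above, and moreover: a) If $\tilde{\mathcal E}\ne\emptyset$, every element of $\varinjlim\mathbb ZE$ is of the form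 $\lambda^E(c)+S$ with $E\in\tilde{\mathcal E}$, $c\in\mathbb ZE$. One has $\lambda^D(c)+S=0$ if and only if $\mathcal I^{DE}(c)=0$ for some $E\in\tilde{\mathcal E}$ with $D\subseteq E$. For $c\in\mathbb ZD$ and $d\in\mathbb ZE$ let $c\sim d$ if $\mathcal I^{DF}(c)=\mathcal I^{EF}(d)$ for some $F\in\tilde{\mathcal E}$ with $D,E\subseteq F$. This is an equivalence relation on the disjoint union $\bigsqcup_{E\in\tilde{\mathcal E}}\mathbb ZE$, and, if $\tilde{\mathcal E}\neq\emptyset$, the set of classes $[\![c]\!]$ is a $\mathbb Z$-module with $[\![c]\!]+[\![d]\!]=[\![\mathcal I^{DF}(c)+\mathcal I^{EF}(d)]\!]$ for all $F\in\tilde{\mathcal E}$ with $D,E\subseteq F$, and $\lambda^E(c)+S\mapsto[\![c]\!]$ defines an isomorphism of $\varinjlim\mathbb ZE$ with it. b) For every short exact sequence $0\to A\to B\to C\to0$ of direct systems of $\mathbb Z$-modules over $(\tilde{\mathcal E},\subseteq)$, the induced sequence $0\to\varinjlim A^i\to\varinjlim B^i\to\varinjlim C^i\to0$ is exact. c) For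 every morphism $g:A\to B$ of direct systems of $\mathbb Z$-modules over $(\tilde{\mathcal E},\subseteq)$ with all $g^i$ injective, the quotients $B^i/g^i(A^i)$ with the induced maps form a direct system, the induced map $\varinjlim A^i\to\varinjlim B^i$ is injective, and there is a unique isomorphism $\varinjlim(B^i/g^i(A^i))\cong\varinjlim B^i/\varinjlim A^i$ that is compatible with the canonical maps from the $B^i$. -/

import Mathlib

open Set Filter Topology
open scoped Manifold ContDiff

/-! ## Surfaces, symplectic forms, hyperbolic fixed points -/

/-- The Euclidean plane, model space of all surfaces below. -/
abbrev Plane : Type := EuclideanSpace ℝ (Fin 2)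

/-- `M` is diffeomorphic to the plane, or it is a closed connected surface which is not a
sphere. As `M` will carry a symplectic form, it is orientable, and the second alternative says
that `M` is a closed surface of genus at least one. -/
def IsPlaneOrClosedSurface (M : Type*) [TopologicalSpace M] [ChartedSpace Plane M] : Prop :=
  Nonempty (M ≃ₘ⟮𝓡 2, 𝓡 2⟯ Plane) ∨
    (T2Space M ∧ CompactSpace M ∧ ConnectedSpace M ∧
      IsEmpty (M ≃ₜ Metric.sphere (0 : EuclideanSpace ℝ (Fin 3)) 1))

/-- A symplectic form on a surface: a smooth nondegenerate 2-form. (It is automatically closed,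
there are no nonzero 3-forms in dimension two.) -/
structure SymplecticForm (M : Type*) [TopologicalSpace M] [ChartedSpace Plane M]
    [IsManifold (𝓡 2) ∞ M] where
  form : ∀ p : M, TangentSpace (𝓡 2) p →L[ℝ] TangentSpace (𝓡 2) p →L[ℝ] ℝ
  alternating : ∀ (p : M) (v : TangentSpace (𝓡 2) p), form p v v = 0
  nondegenerate : ∀ (p : M) (v : TangentSpace (𝓡 2) p), (∀ w, form p v w = 0) → v = 0
  smooth : ContMDiff (𝓡 2) ((𝓡 2).prod 𝓘(ℝ, Plane →L[ℝ] Plane →L[ℝ] ℝ)) ∞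
    (fun p : M => Bundle.TotalSpace.mk' (Plane →L[ℝ] Plane →L[ℝ] ℝ)
      (E := fun p : M => TangentSpace (𝓡 2) p →L[ℝ] TangentSpace (𝓡 2) p →L[ℝ] ℝ) p (form p))

/-- No complex eigenvalue of the linear map `A` has modulus one. -/
def IsHyperbolicMap (A : Plane →L[ℝ] Plane) : Prop :=
  ∀ z : ℂ, ((LinearMap.charpoly (A : Plane →ₗ[ℝ] Plane)).map (algebraMap ℝ ℂ)).IsRoot z → ‖z‖ ≠ 1

/-- A symplectomorphism `φ` of a surface with symplectic form `area`, with a hyperbolic fixed point `x`. -/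
structure HyperbolicSymplecto (M : Type*) [TopologicalSpace M] [ChartedSpace Plane M]
    [IsManifold (𝓡 2) ∞ M] where
  area : SymplecticForm M
  φ : M ≃ₘ⟮𝓡 2, 𝓡 2⟯ M
  symplectic : ∀ (p : M) (v w : TangentSpace (𝓡 2) p),
    area.form (φ p) (mfderiv (𝓡 2) (𝓡 2) φ p v) (mfderiv (𝓡 2) (𝓡 2) φ p w) = area.form p v w
  x : M
  fixed : φ x = x
  hyperbolic : IsHyperbolicMap (mfderiv (𝓡 2) (𝓡 2) φ x)

section curves

variable {M : Type*} [TopologicalSpace M] [ChartedSpace Plane M]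

/-- The velocity of a curve (in the preferred chart at its current point). -/
noncomputable def velocity (γ : ℝ → M) (t : ℝ) : Plane :=
  mfderiv 𝓘(ℝ, ℝ) (𝓡 2) γ t (1 : ℝ)

/-- `γ` is a parametrization of `W` as an injectively immersed line, based at `x`. -/
structure IsLineParam (W : Set M) (x : M) (γ : ℝ → M) : Prop where
  smooth : ContMDiff 𝓘(ℝ, ℝ) (𝓡 2) ∞ γ
  immersion : ∀ t, velocity γ t ≠ 0
  injective : Function.Injective γ
  base : γ 0 = x
  range_eq : Set.range γ = W

/-- The path `c` runs from `p` to `q` through the segment `[p, q]` of the immersed line `W`. -/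
def RunsThroughSegment (W : Set M) (x : M) {p q : M} (c : Path p q) : Prop :=
  ∃ γ : ℝ → M, IsLineParam W x γ ∧
    ∃ a b : ℝ, ∀ t : unitInterval, c t = γ (AffineMap.lineMap a b (t : ℝ))

end curves

/-! ## Di-gons -/

/-- The di-gon: a lens with exactly two vertices, both convex, at `(-1, 0)` and `(1, 0)`. -/
def digon : Set Plane := {z | |z 1| ≤ 1 - z 0 ^ 2}

/-- The upper boundary of the di-gon. -/
def digonUpper : Set Plane := {z ∈ digon | z 1 = 1 - z 0 ^ 2}

/-- The lower boundary of the di-gon. -/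
def digonLower : Set Plane := {z ∈ digon | z 1 = -(1 - z 0 ^ 2)}

/-! ## Homoclinic points, Maslov index, signs -/

namespace HyperbolicSymplecto

variable {M : Type*} [TopologicalSpace M] [ChartedSpace Plane M] [IsManifold (𝓡 2) ∞ M]
variable (T : HyperbolicSymplecto M)

/-- The stable manifold of the fixed point. -/
def Ws : Set M := {p | Tendsto (fun n : ℕ => T.φ^[n] p) atTop (𝓝 T.x)}

/-- The unstable manifold of the fixed point. -/
def Wu : Set M := {p | Tendsto (fun n : ℕ => T.φ.symm^[n] p) atTop (𝓝 T.x)}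

/-- The set of homoclinic points (the fixed point is one of them). -/
def homoclinic : Set M := T.Ws ∩ T.Wu

/-- The stable and unstable manifold intersect transversely. -/
def Transverse : Prop :=
  ∀ γs γu : ℝ → M, IsLineParam T.Ws T.x γs → IsLineParam T.Wu T.x γu →
    ∀ s t : ℝ, γs s = γu t → LinearIndependent ℝ ![velocity γs s, velocity γu t]

/-- `φ` preserves the orientation of the immersed line `W`. -/
def PreservesOrientationOf (W : Set M) : Prop :=
  ∀ γ : ℝ → M, IsLineParam W T.x γ → ∃ τ : ℝ → ℝ, StrictMono τ ∧ ∀ t, T.φ (γ t) = γ (τ t)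

/-- `φ` is `W`-orientation preserving. -/
def WOrientationPreserving : Prop :=
  T.PreservesOrientationOf T.Ws ∧ T.PreservesOrientationOf T.Wu

/-- The set of contractible homoclinic points `p`: the loop which runs from `x` to `p` through the
segment of the unstable manifold and back through the segment of the stable manifold is
null-homotopic. -/
def contractible : Set M :=
  {p ∈ T.homoclinic | ∃ (α : Path T.x p) (β : Path p T.x),
    RunsThroughSegment T.Wu T.x α ∧ RunsThroughSegment T.Ws T.x β ∧
      (α.trans β).Homotopic (Path.refl T.x)}

/-- Data that compute the relative Maslov index `μ(p, q)` of homoclinic points `p`, `q` in the same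
homotopy class: a homotopy `F` with fixed end points from the segment `[p, q]` of the unstable
manifold (bottom edge of the square) to the segment `[p, q]` of the stable manifold (top edge), a
positively oriented continuous frame `e₁, e₂` along `F`, constant on the two edges that are mapped
to `p` and `q`, and continuous angles `θu`, `θs` of the tangent lines of the two segments with
respect to this frame. -/
structure MaslovData (p q : M) where
  γu : ℝ → M
  γs : ℝ → M
  param_u : IsLineParam T.Wu T.x γu
  param_s : IsLineParam T.Ws T.x γs
  a : ℝ
  a' : ℝ
  b : ℝ
  b' : ℝ
  F : C(unitInterval × unitInterval, M)
  bottom : ∀ s : unitInterval, F (s, 0) = γu (AffineMap.lineMap a a' (s : ℝ))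
  top : ∀ s : unitInterval, F (s, 1) = γs (AffineMap.lineMap b b' (s : ℝ))
  left : ∀ t, F (0, t) = p
  right : ∀ t, F (1, t) = q
  e₁ : ∀ z, TangentSpace (𝓡 2) (F z)
  e₂ : ∀ z, TangentSpace (𝓡 2) (F z)
  continuous_e₁ : Continuous (fun z => (⟨F z, e₁ z⟩ : TangentBundle (𝓡 2) M))
  continuous_e₂ : Continuous (fun z => (⟨F z, e₂ z⟩ : TangentBundle (𝓡 2) M))
  positive : ∀ z, 0 < T.area.form (F z) (e₁ z) (e₂ z)
  left_const : ∀ t, (e₁ (0, t) : Plane) = e₁ (0, 0) ∧ (e₂ (0, t) : Plane) = e₂ (0, 0)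
  right_const : ∀ t, (e₁ (1, t) : Plane) = e₁ (1, 0) ∧ (e₂ (1, t) : Plane) = e₂ (1, 0)
  θu : C(unitInterval, ℝ)
  θs : C(unitInterval, ℝ)
  angle_u : ∀ s : unitInterval, ∃ c : ℝ, c ≠ 0 ∧
    velocity γu (AffineMap.lineMap a a' (s : ℝ)) =
      c • (Real.cos (θu s) • (e₁ (s, 0) : Plane) + Real.sin (θu s) • (e₂ (s, 0) : Plane))
  angle_s : ∀ s : unitInterval, ∃ c : ℝ, c ≠ 0 ∧
    velocity γs (AffineMap.lineMap b b' (s : ℝ)) =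
      c • (Real.cos (θs s) • (e₁ (s, 1) : Plane) + Real.sin (θs s) • (e₂ (s, 1) : Plane))

variable {T} in
/-- Consider the loop from `p` through `[p, q]` in the unstable manifold to `q` and back through
`[p, q]` in the stable manifold. Follow its tangent line; at the vertex `q` turn it from the
unstable to the stable direction by an angle in `(0, π)`, at the vertex `p` from the stable to the
unstable direction by an angle in `(-π, 0)`. The Maslov index is the total angle divided by `π`,
that is, twice the winding number. If `θs - θu` lies in `(m π, (m + 1) π)` at `p` and in
`(n π, (n + 1) π)` at `q`, then this is `m - n`. -/
noncomputable def MaslovData.index {p q : M} (d : T.MaslovData p q) : ℤ :=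
  ⌊(d.θs 0 - d.θu 0) / Real.pi⌋ - ⌊(d.θs 1 - d.θu 1) / Real.pi⌋

open Classical in
/-- The relative Maslov index `μ(p, q)`. It does not depend on the data used to compute it. -/
noncomputable def maslov (p q : M) : ℤ :=
  if h : Nonempty (T.MaslovData p q) then (Classical.choice h).index else 0

/-- The grading `μ(p) = μ(p, x)` of a contractible homoclinic point. -/
noncomputable def grading (p : M) : ℤ := T.maslov p T.x

/-- The space of smooth immersed orientation preserving di-gons from `p` to `q`, with lower boundary
in the unstable and upper boundary in the stable manifold (smoothness up to the boundary means
smoothness on an open neighbourhood). -/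
def immersedDigons (p q : M) : Set (Plane → M) :=
  {v | (∃ U : Set Plane, IsOpen U ∧ digon ⊆ U ∧ ContMDiffOn (𝓡 2) (𝓡 2) ∞ v U) ∧
    (∀ z ∈ digon, 0 < T.area.form (v z)
      (mfderiv (𝓡 2) (𝓡 2) v z (EuclideanSpace.single 0 1 : Plane))
      (mfderiv (𝓡 2) (𝓡 2) v z (EuclideanSpace.single 1 1 : Plane))) ∧
    (∀ z ∈ digonLower, v z ∈ T.Wu) ∧ (∀ z ∈ digonUpper, v z ∈ T.Ws) ∧
    v !₂[-1, 0] = p ∧ v !₂[1, 0] = q}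

open Classical in
/-- The sign `n(p, q)`, for `μ(p, q) = 1`, when the unstable manifold is oriented by its
parametrization `γu`: it is zero if there is no immersed di-gon from `p` to `q` (equivalently, none
up to reparametrization), and otherwise it compares the direction from `p` to `q` in the unstable
manifold with the orientation. -/
noncomputable def sign (γu : ℝ → M) (p q : M) : ℤ :=
  if (T.immersedDigons p q).Nonempty then
    if ∃ a b : ℝ, a < b ∧ γu a = p ∧ γu b = q then 1 else -1
  else 0

end HyperbolicSymplecto

/-! ## The free modules, the boundary operator, complete sets -/

/-- The free `ℤ`-module `ℤE` generated by the points of a finite set `E`. -/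
abbrev FreeMod {M : Type*} (E : Finset M) : Type _ := E →₀ ℤ

/-- The map `ℤD → ℤE` induced by an inclusion `D ⊆ E`. -/
noncomputable def freeIncl {M : Type*} {D E : Finset M} (h : D ⊆ E) :
    FreeMod D →ₗ[ℤ] FreeMod E :=
  Finsupp.lmapDomain ℤ ℤ (fun p : D => (⟨p.1, h p.2⟩ : E))

/-- The inclusions `ℤD → ℤE` for `D ⊆ E` in a family `S` of finite sets ordered by inclusion. -/
noncomputable def inclSystem {M : Type*} (S : Set (Finset M)) (D E : S) (h : D ≤ E) :
    FreeMod D.1 →ₗ[ℤ] FreeMod E.1 :=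
  freeIncl h

namespace HyperbolicSymplecto

variable {M : Type*} [TopologicalSpace M] [ChartedSpace Plane M] [IsManifold (𝓡 2) ∞ M]
variable (T : HyperbolicSymplecto M)

/-- The candidate boundary operator on `ℤE`, when the unstable manifold is oriented by `γu`:
`∂ p` is the sum of `n(p, q) q` over all `q ∈ E` with `μ(q) = μ(p) - 1`. -/
noncomputable def boundary (γu : ℝ → M) (E : Finset M) : FreeMod E →ₗ[ℤ] FreeMod E :=
  Finsupp.linearCombination ℤ (fun p : E =>
    ∑ q ∈ (Finset.univ : Finset E).filter (fun q : E => T.grading q = T.grading p - 1),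
      T.sign γu p q • Finsupp.single q (1 : ℤ))

/-- `E` is `∂`-complete: the boundary operator squares to zero. (Changing the orientation of the
unstable manifold replaces `∂` by `-∂`, so the condition does not depend on it.) -/
def IsComplete (E : Finset M) : Prop :=
  ∀ γu : ℝ → M, IsLineParam T.Wu T.x γu → T.boundary γu E ∘ₗ T.boundary γu E = 0

/-- The family of all `∂`-complete finite sets of contractible homoclinic points. -/
def completeSets : Set (Finset M) :=
  {E | (E : Set M) ⊆ T.contractible ∧ T.IsComplete E}

end HyperbolicSymplecto

/-! ## Direct systems of modules and their direct limits -/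

noncomputable section algebra

universe r u v w

/-- `0 → A → B → C → 0` is exact. -/
def IsShortExact {R : Type*} [Ring R] {A B C : Type*} [AddCommGroup A] [Module R A]
    [AddCommGroup B] [Module R B] [AddCommGroup C] [Module R C]
    (g : A →ₗ[R] B) (h : B →ₗ[R] C) : Prop :=
  Function.Injective g ∧ Function.Exact g h ∧ Function.Surjective h

variable {R : Type r} [Ring R] {ι : Type u} [Preorder ι]
variable {A : ι → Type v} [∀ i, AddCommGroup (A i)] [∀ i, Module R (A i)]

/-- `(A, α)` is a direct system of `R`-modules. -/
def IsDirectSystem (α : ∀ i j, i ≤ j → A i →ₗ[R] A j) : Prop :=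
  (∀ i, α i i le_rfl = LinearMap.id) ∧
    ∀ i j k (hij : i ≤ j) (hjk : j ≤ k), α j k hjk ∘ₗ α i j hij = α i k (hij.trans hjk)

/-- The module `L` with the maps `γ i : A i → L` is a direct limit of the system `(A, α)` in the
category of `R`-modules. -/
def IsDirectLimit (α : ∀ i j, i ≤ j → A i →ₗ[R] A j) {L : Type*} [AddCommGroup L] [Module R L]
    (γ : ∀ i, A i →ₗ[R] L) : Prop :=
  (∀ i j (h : i ≤ j), γ j ∘ₗ α i j h = γ i) ∧
    ∀ (P : Type w) [AddCommGroup P] [Module R P] (g : ∀ i, A i →ₗ[R] P),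
      (∀ i j (h : i ≤ j), g j ∘ₗ α i j h = g i) → ∃! θ : L →ₗ[R] P, ∀ i, θ ∘ₗ γ i = g i

/-- The submodule `S` of the direct sum which is generated by all `λ j (α i j c) - λ i c`, where
`λ i : A i → ⨁ i, A i` are the insertions. -/
def limitRelations [DecidableEq ι] (α : ∀ i j, i ≤ j → A i →ₗ[R] A j) :
    Submodule R (DirectSum ι A) :=
  Submodule.span R {z | ∃ (i j : ι) (h : i ≤ j) (c : A i),
    z = DirectSum.lof R ι A j (α i j h c) - DirectSum.lof R ι A i c}

/-- The direct limit `(⨁ i, A i) / S`. -/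
abbrev DirLim [DecidableEq ι] (α : ∀ i j, i ≤ j → A i →ₗ[R] A j) : Type _ :=
  DirectSum ι A ⧸ limitRelations α

/-- The canonical map `A i → (⨁ i, A i) / S`, which sends `c` to `λ i c + S`. -/
def toDirLim [DecidableEq ι] (α : ∀ i j, i ≤ j → A i →ₗ[R] A j) (i : ι) : A i →ₗ[R] DirLim α :=
  (limitRelations α).mkQ ∘ₗ DirectSum.lof R ι A i

/-- The direct limit of `(A, α)` exists: it is `(⨁ i, A i) / S` with the canonical maps. -/
def HasDirLim [DecidableEq ι] (α : ∀ i j, i ≤ j → A i →ₗ[R] A j) : Prop :=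
  IsDirectLimit.{r, u, v, w} α (toDirLim α)

/-- Elements `c ∈ A i` and `d ∈ A j` of the disjoint union are related if they have the same
image in some `A k`. -/
def EventuallyEqual (α : ∀ i j, i ≤ j → A i →ₗ[R] A j) (c d : Σ i, A i) : Prop :=
  ∃ (k : ι) (h : c.1 ≤ k) (h' : d.1 ≤ k), α c.1 k h c.2 = α d.1 k h' d.2

/-- The explicit form of a direct limit over a directed index set: every element is of the form
`λ i c + S`; such an element is zero if and only if `c` is mapped to zero by some transition map;
being eventually equal is an equivalence relation on the disjoint union of all `A i`, and the
limit is isomorphic to the set of equivalence classes with the addition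
`⟦c⟧ + ⟦d⟧ = ⟦α i k c + α j k d⟧`, by the map that sends `λ i c + S` to `⟦c⟧`. -/
def HasDirectedForm [DecidableEq ι] (α : ∀ i j, i ≤ j → A i →ₗ[R] A j) : Prop :=
  (Nonempty ι → ∀ z : DirLim α, ∃ (i : ι) (c : A i), z = toDirLim α i c) ∧
  (∀ (i : ι) (c : A i), toDirLim α i c = 0 ↔ ∃ (k : ι) (h : i ≤ k), α i k h c = 0) ∧
  ∃ heq : Equivalence (EventuallyEqual α), Nonempty ι →
    ∃ (_ : AddCommGroup (Quotient (Setoid.mk _ heq))) (_ : Module R (Quotient (Setoid.mk _ heq))),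
      (∀ (i j k : ι) (hi : i ≤ k) (hj : j ≤ k) (c : A i) (d : A j),
        (Quotient.mk (Setoid.mk _ heq) ⟨i, c⟩ + Quotient.mk (Setoid.mk _ heq) ⟨j, d⟩ :
            Quotient (Setoid.mk _ heq)) =
          Quotient.mk (Setoid.mk _ heq) ⟨k, α i k hi c + α j k hj d⟩) ∧
      ∃ Ψ : DirLim α ≃ₗ[R] Quotient (Setoid.mk _ heq),
        ∀ (i : ι) (c : A i), Ψ (toDirLim α i c) = Quotient.mk (Setoid.mk _ heq) ⟨i, c⟩

variable {B : ι → Type v} [∀ i, AddCommGroup (B i)] [∀ i, Module R (B i)]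

/-- The maps `g i : A i → B i` form a morphism of systems. -/
def IsSystemHom (α : ∀ i j, i ≤ j → A i →ₗ[R] A j) (β : ∀ i j, i ≤ j → B i →ₗ[R] B j)
    (g : ∀ i, A i →ₗ[R] B i) : Prop :=
  ∀ i j (h : i ≤ j), g j ∘ₗ α i j h = β i j h ∘ₗ g i

/-- The map of direct limits which is induced by a morphism of systems; it sends
`∑ λ i (a i) + S` to `∑ λ i (g i (a i)) + S`. -/
def dirLimMap [DecidableEq ι] (α : ∀ i j, i ≤ j → A i →ₗ[R] A j)
    (β : ∀ i j, i ≤ j → B i →ₗ[R] B j) (g : ∀ i, A i →ₗ[R] B i) (hg : IsSystemHom α β g) :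
    DirLim α →ₗ[R] DirLim β :=
  Submodule.mapQ _ _ (DirectSum.lmap g) (by
    refine Submodule.span_le.2 ?_
    rintro _ ⟨i, j, h, c, rfl⟩
    refine Submodule.subset_span ⟨i, j, h, g i c, ?_⟩
    rw [map_sub, DirectSum.lmap_lof, DirectSum.lmap_lof]
    exact congrArg (fun y => DirectSum.lof R ι B j y - DirectSum.lof R ι B i (g i c))
      (LinearMap.congr_fun (hg i j h) c))

/-- The transition maps `B i / g i (A i) → B j / g j (A j)` induced by those of `B`. -/
def quotientSystem (α : ∀ i j, i ≤ j → A i →ₗ[R] A j) (β : ∀ i j, i ≤ j → B i →ₗ[R] B j)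
    (g : ∀ i, A i →ₗ[R] B i) (hg : IsSystemHom α β g) (i j : ι) (h : i ≤ j) :
    (B i ⧸ LinearMap.range (g i)) →ₗ[R] (B j ⧸ LinearMap.range (g j)) :=
  Submodule.mapQ (LinearMap.range (g i)) (LinearMap.range (g j)) (β i j h) (by
    intro b hb
    obtain ⟨a, rfl⟩ := LinearMap.mem_range.mp hb
    exact ⟨α i j h a, LinearMap.congr_fun (hg i j h) a⟩)

/-- Direct limits over the index set `ι` preserve short exact sequences of direct systems of
`R`-modules. -/
def DirLimPreservesShortExact (R : Type r) [Ring R] (ι : Type u) [Preorder ι]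
    [DecidableEq ι] : Prop :=
  ∀ (A B C : ι → Type v) [∀ i, AddCommGroup (A i)] [∀ i, Module R (A i)]
    [∀ i, AddCommGroup (B i)] [∀ i, Module R (B i)] [∀ i, AddCommGroup (C i)]
    [∀ i, Module R (C i)] (α : ∀ i j, i ≤ j → A i →ₗ[R] A j)
    (β : ∀ i j, i ≤ j → B i →ₗ[R] B j) (γ : ∀ i j, i ≤ j → C i →ₗ[R] C j)
    (g : ∀ i, A i →ₗ[R] B i) (h : ∀ i, B i →ₗ[R] C i)
    (hg : IsSystemHom α β g) (hh : IsSystemHom β γ h),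
    IsDirectSystem α → IsDirectSystem β → IsDirectSystem γ →
    (∀ i, IsShortExact (g i) (h i)) → IsShortExact (dirLimMap α β g hg) (dirLimMap β γ h hh)

/-- Direct limits over the index set `ι` are compatible with quotients of direct systems of
`R`-modules: for a morphism `g : A → B` with all `g i` injective, the quotients `B i / g i (A i)`
form a direct system, the limit of `A` injects into the limit of `B`, and there is a unique
isomorphism from the limit of the quotients to the quotient of the limits that is compatible with
the canonical maps from the modules `B i`. -/
def DirLimPreservesQuotients (R : Type r) [Ring R] (ι : Type u) [Preorder ι]
    [DecidableEq ι] : Prop :=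
  ∀ (A B : ι → Type v) [∀ i, AddCommGroup (A i)] [∀ i, Module R (A i)]
    [∀ i, AddCommGroup (B i)] [∀ i, Module R (B i)] (α : ∀ i j, i ≤ j → A i →ₗ[R] A j)
    (β : ∀ i j, i ≤ j → B i →ₗ[R] B j) (g : ∀ i, A i →ₗ[R] B i) (hg : IsSystemHom α β g),
    IsDirectSystem α → IsDirectSystem β → (∀ i, Function.Injective (g i)) →
    IsDirectSystem (quotientSystem α β g hg) ∧
    Function.Injective (dirLimMap α β g hg) ∧
    ∃! Φ : DirLim (quotientSystem α β g hg) ≃ₗ[R]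
        (DirLim β ⧸ LinearMap.range (dirLimMap α β g hg)),
      ∀ (i : ι) (b : B i),
        Φ (toDirLim (quotientSystem α β g hg) i (Submodule.Quotient.mk b)) =
          Submodule.Quotient.mk (toDirLim β i b)

end algebra

/-! ### Direct systems and the universal property over an arbitrary preorder. -/

section directLimits

universe r u v w

variable {R : Type r} [Ring R] {ι : Type u} [Preorder ι]
variable {A : ι → Type v} [∀ i, AddCommGroup (A i)] [∀ i, Module R (A i)]
variable {B : ι → Type v} [∀ i, AddCommGroup (B i)] [∀ i, Module R (B i)]

/-! The transition maps between the free modules are functorial in the inclusion of finite sets, so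
every family of finite sets gives a direct system; the remaining claims are algebra over an
arbitrary ring `R`.

The quotient of the direct sum by `limitRelations` has the universal property over any preorder: a
compatible family kills the generators of the relations, and the classes of the insertions span the
quotient.

If the index set is directed, the terms of a finite sum can be moved to a common index. Hence every
element of the limit is zero or comes from a single index (`dirLim_eq_zero_or_exists`). The other
pillar is `IsDirectSystem.toDirLim_eq_zero_iff`: an element becomes zero in the limit only if some
transition map already kills it. With these two facts, equality in the limit becomes eventual
equality, and exactness is checked on representatives after passing to a larger index. The statement
on quotients is exactness applied to `A → B → B / A`, together with the first isomorphism theorem.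
-/

theorem IsDirectSystem.directedSystem {α : ∀ i j, i ≤ j → A i →ₗ[R] A j}
    (hα : IsDirectSystem α) : DirectedSystem A (fun i j h => α i j h) where
  map_self i x := LinearMap.congr_fun (hα.1 i) x
  map_map k j i hij hjk x := LinearMap.congr_fun (hα.2 i j k hij hjk) x

theorem IsDirectSystem.quotientSystem {α : ∀ i j, i ≤ j → A i →ₗ[R] A j}
    {β : ∀ i j, i ≤ j → B i →ₗ[R] B j} {g : ∀ i, A i →ₗ[R] B i} (hβ : IsDirectSystem β)
    (hg : IsSystemHom α β g) : IsDirectSystem (quotientSystem α β g hg) := by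
  refine ⟨fun i => ?_, fun i j k hij hjk => ?_⟩
  · ext b
    exact congrArg Submodule.Quotient.mk (LinearMap.congr_fun (hβ.1 i) b)
  · ext b
    exact congrArg Submodule.Quotient.mk (LinearMap.congr_fun (hβ.2 i j k hij hjk) b)

variable [DecidableEq ι]

theorem toDirLim_transition (α : ∀ i j, i ≤ j → A i →ₗ[R] A j) {i j : ι} (h : i ≤ j) (c : A i) :
    toDirLim α j (α i j h c) = toDirLim α i c :=
  (Submodule.Quotient.eq _).2 (Submodule.subset_span ⟨i, j, h, c, rfl⟩)

/-- The linear map out of the direct limit given by a compatible family. -/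
noncomputable def dirLimLift {P : Type*} [AddCommGroup P] [Module R P]
    (α : ∀ i j, i ≤ j → A i →ₗ[R] A j) (g : ∀ i, A i →ₗ[R] P)
    (hg : ∀ i j (h : i ≤ j), g j ∘ₗ α i j h = g i) : DirLim α →ₗ[R] P :=
  (limitRelations α).liftQ (DirectSum.toModule R ι P g) (by
    refine Submodule.span_le.2 ?_
    rintro _ ⟨i, j, h, c, rfl⟩
    rw [SetLike.mem_coe, LinearMap.mem_ker, map_sub, DirectSum.toModule_lof,
      DirectSum.toModule_lof, sub_eq_zero]
    exact LinearMap.congr_fun (hg i j h) c)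

theorem dirLimLift_toDirLim {P : Type*} [AddCommGroup P] [Module R P]
    (α : ∀ i j, i ≤ j → A i →ₗ[R] A j) (g : ∀ i, A i →ₗ[R] P)
    (hg : ∀ i j (h : i ≤ j), g j ∘ₗ α i j h = g i) (i : ι) (c : A i) :
    dirLimLift α g hg (toDirLim α i c) = g i c :=
  DirectSum.toModule_lof R i c

theorem dirLim_hom_ext {P : Type*} [AddCommGroup P] [Module R P]
    {α : ∀ i j, i ≤ j → A i →ₗ[R] A j} {f f' : DirLim α →ₗ[R] P}
    (h : ∀ i c, f (toDirLim α i c) = f' (toDirLim α i c)) : f = f' := by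
  refine Submodule.linearMap_qext _ (DirectSum.linearMap_ext R fun i => LinearMap.ext fun c => ?_)
  exact h i c

theorem hasDirLim (α : ∀ i j, i ≤ j → A i →ₗ[R] A j) : HasDirLim.{r, u, v, w} α := by
  refine ⟨fun i j h => LinearMap.ext fun c => toDirLim_transition α h c,
    fun P _ _ g hg => ⟨dirLimLift α g hg,
      fun i => LinearMap.ext fun c => dirLimLift_toDirLim α g hg i c, fun θ hθ => ?_⟩⟩
  refine dirLim_hom_ext fun i c => ?_
  rw [dirLimLift_toDirLim]
  exact LinearMap.congr_fun (hθ i) c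

theorem dirLimMap_toDirLim {α : ∀ i j, i ≤ j → A i →ₗ[R] A j}
    {β : ∀ i j, i ≤ j → B i →ₗ[R] B j} {g : ∀ i, A i →ₗ[R] B i} (hg : IsSystemHom α β g)
    (i : ι) (c : A i) : dirLimMap α β g hg (toDirLim α i c) = toDirLim β i (g i c) :=
  congrArg (limitRelations β).mkQ (DirectSum.lmap_lof g i c)

/-! ### Elements of a limit over a directed index set. -/

variable [IsDirectedOrder ι]

/-- Two representatives can be added at a common upper bound of their indices. Zero is a separate
case because the index set may be empty. -/
theorem dirLim_eq_zero_or_exists (α : ∀ i j, i ≤ j → A i →ₗ[R] A j) (z : DirLim α) :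
    z = 0 ∨ ∃ i c, z = toDirLim α i c := by
  obtain ⟨y, rfl⟩ := Submodule.mkQ_surjective _ z
  induction y using DirectSum.induction_on with
  | zero => exact Or.inl (map_zero _)
  | of i c => exact Or.inr ⟨i, c, rfl⟩
  | add x y hx hy =>
    rw [map_add]
    rcases hx with hx | ⟨i, c, hx⟩
    · rwa [hx, zero_add]
    rcases hy with hy | ⟨j, d, hy⟩
    · rw [hx, hy, add_zero]
      exact Or.inr ⟨i, c, rfl⟩
    obtain ⟨k, hik, hjk⟩ := exists_ge_ge i j
    refine Or.inr ⟨k, α i k hik c + α j k hjk d, ?_⟩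
    rw [hx, hy, map_add, toDirLim_transition, toDirLim_transition]

theorem exists_eq_toDirLim [Nonempty ι] (α : ∀ i j, i ≤ j → A i →ₗ[R] A j) (z : DirLim α) :
    ∃ i c, z = toDirLim α i c := by
  rcases dirLim_eq_zero_or_exists α z with rfl | h
  · exact ⟨Classical.arbitrary ι, 0, (map_zero _).symm⟩
  · exact h

theorem IsDirectSystem.toDirLim_eq_zero_iff {α : ∀ i j, i ≤ j → A i →ₗ[R] A j}
    (hα : IsDirectSystem α) {i : ι} {c : A i} :
    toDirLim α i c = 0 ↔ ∃ (k : ι) (h : i ≤ k), α i k h c = 0 := by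
  refine ⟨fun h => ?_, fun ⟨k, hik, h⟩ => ?_⟩
  · have := hα.directedSystem
    -- Compare with `Module.DirectLimit`: its canonical maps are compatible, so they factor through
    -- `DirLim α`. Hence `c` also vanishes there, and `zero_exact` provides the index at which it
    -- dies.
    have hc := dirLimLift_toDirLim α (Module.DirectLimit.of R ι A α)
      (fun i j hij => LinearMap.ext fun c => Module.DirectLimit.of_f) i c
    rw [h, map_zero] at hc
    exact Module.DirectLimit.of.zero_exact hc.symm
  · rw [← toDirLim_transition α hik, h, map_zero]

theorem IsDirectSystem.toDirLim_eq_iff {α : ∀ i j, i ≤ j → A i →ₗ[R] A j}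
    (hα : IsDirectSystem α) (c d : Σ i, A i) :
    toDirLim α c.1 c.2 = toDirLim α d.1 d.2 ↔ EventuallyEqual α c d := by
  refine ⟨fun h => ?_, fun ⟨k, hc, hd, h⟩ => ?_⟩
  · obtain ⟨k, hck, hdk⟩ := exists_ge_ge c.1 d.1
    rw [← toDirLim_transition α hck, ← toDirLim_transition α hdk, ← sub_eq_zero, ← map_sub,
      hα.toDirLim_eq_zero_iff] at h
    obtain ⟨l, hkl, h⟩ := h
    rw [map_sub, sub_eq_zero] at h
    refine ⟨l, hck.trans hkl, hdk.trans hkl, ?_⟩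
    rw [← hα.2 _ _ _ hck hkl, ← hα.2 _ _ _ hdk hkl]
    exact h
  · rw [← toDirLim_transition α hc, ← toDirLim_transition α hd, h]

/-- Being eventually equal is the kernel relation of the map from the disjoint union to the limit,
hence an equivalence. For nonempty `ι` that map is onto, so the classes biject with the limit and
inherit its module structure. -/
theorem IsDirectSystem.hasDirectedForm {α : ∀ i j, i ≤ j → A i →ₗ[R] A j}
    (hα : IsDirectSystem α) : HasDirectedForm α := by
  have heq : Equivalence (EventuallyEqual α) :=
    { refl := fun c => (hα.toDirLim_eq_iff c c).1 rfl
      symm := fun h => (hα.toDirLim_eq_iff _ _).1 ((hα.toDirLim_eq_iff _ _).2 h).symm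
      trans := fun h h' => (hα.toDirLim_eq_iff _ _).1
        (((hα.toDirLim_eq_iff _ _).2 h).trans ((hα.toDirLim_eq_iff _ _).2 h')) }
  refine ⟨fun _ z => exists_eq_toDirLim α z, fun i c => hα.toDirLim_eq_zero_iff, heq,
    fun _ => ?_⟩
  let e : Quotient (Setoid.mk _ heq) ≃ DirLim α := Equiv.ofBijective
    (Quotient.lift (fun c : Σ i, A i => toDirLim α c.1 c.2)
      fun c d h => (hα.toDirLim_eq_iff c d).2 h) (by
    constructor
    · rintro ⟨c⟩ ⟨d⟩ h
      exact Quotient.sound ((hα.toDirLim_eq_iff c d).1 h)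
    · intro z
      obtain ⟨i, c, rfl⟩ := exists_eq_toDirLim α z
      exact ⟨Quotient.mk _ ⟨i, c⟩, rfl⟩)
  have he (i : ι) (c : A i) : e (Quotient.mk _ ⟨i, c⟩) = toDirLim α i c := rfl
  -- The structure is pulled back along `e`, which makes `e` linear; the addition rule can then be
  -- verified in the limit.
  let := e.addCommGroup
  let := e.module R
  refine ⟨inferInstance, inferInstance, fun i j k hi hj c d => e.injective ?_,
    (e.linearEquiv R).symm, fun i c => e.symm_apply_eq.2 (he i c).symm⟩
  rw [he, map_add (toDirLim α k), toDirLim_transition, toDirLim_transition]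
  exact (e.linearEquiv R).map_add _ _

/-! ### Exactness and quotients. -/

theorem dirLimMap_injective {α : ∀ i j, i ≤ j → A i →ₗ[R] A j}
    {β : ∀ i j, i ≤ j → B i →ₗ[R] B j} {g : ∀ i, A i →ₗ[R] B i} (hg : IsSystemHom α β g)
    (hβ : IsDirectSystem β) (hinj : ∀ i, Function.Injective (g i)) :
    Function.Injective (dirLimMap α β g hg) := by
  refine (injective_iff_map_eq_zero _).2 fun z hz => ?_
  rcases dirLim_eq_zero_or_exists α z with rfl | ⟨i, a, rfl⟩
  · rfl
  rw [dirLimMap_toDirLim, hβ.toDirLim_eq_zero_iff] at hz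
  obtain ⟨k, hik, h⟩ := hz
  -- The image of `a` may vanish only at the later index `k`, so injectivity is applied to `g k` and
  -- not to `g i`.
  have h' : g k (α i k hik a) = 0 := (LinearMap.congr_fun (hg i k hik) a).trans h
  rw [← toDirLim_transition α hik, (injective_iff_map_eq_zero _).1 (hinj k) _ h', map_zero]

theorem dirLimMap_surjective {α : ∀ i j, i ≤ j → A i →ₗ[R] A j}
    {β : ∀ i j, i ≤ j → B i →ₗ[R] B j} {g : ∀ i, A i →ₗ[R] B i} (hg : IsSystemHom α β g)
    (hsurj : ∀ i, Function.Surjective (g i)) : Function.Surjective (dirLimMap α β g hg) := by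
  intro z
  rcases dirLim_eq_zero_or_exists β z with rfl | ⟨i, b, rfl⟩
  · exact ⟨0, map_zero _⟩
  obtain ⟨a, rfl⟩ := hsurj i b
  exact ⟨toDirLim α i a, dirLimMap_toDirLim hg i a⟩

theorem dirLimMap_exact {C : ι → Type v} [∀ i, AddCommGroup (C i)] [∀ i, Module R (C i)]
    {α : ∀ i j, i ≤ j → A i →ₗ[R] A j} {β : ∀ i j, i ≤ j → B i →ₗ[R] B j}
    {γ : ∀ i j, i ≤ j → C i →ₗ[R] C j} {g : ∀ i, A i →ₗ[R] B i} {h : ∀ i, B i →ₗ[R] C i}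
    (hg : IsSystemHom α β g) (hh : IsSystemHom β γ h) (hγ : IsDirectSystem γ)
    (hex : ∀ i, Function.Exact (g i) (h i)) :
    Function.Exact (dirLimMap α β g hg) (dirLimMap β γ h hh) := by
  refine fun z => ⟨fun hz => ?_, ?_⟩
  · rcases dirLim_eq_zero_or_exists β z with rfl | ⟨i, b, rfl⟩
    · exact ⟨0, map_zero _⟩
    rw [dirLimMap_toDirLim, hγ.toDirLim_eq_zero_iff] at hz
    obtain ⟨k, hik, hk⟩ := hz
    -- At `i` the element `b` need not lie in the kernel of `h i`; its transport to `k` lies in that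
    -- of `h k`, so exactness is used there.
    obtain ⟨a, ha⟩ := (hex k _).1 ((LinearMap.congr_fun (hh i k hik) b).trans hk)
    exact ⟨toDirLim α k a, by rw [dirLimMap_toDirLim, ha, toDirLim_transition]⟩
  · rintro ⟨y, rfl⟩
    rcases dirLim_eq_zero_or_exists α y with rfl | ⟨i, a, rfl⟩
    · rw [map_zero, map_zero]
    · rw [dirLimMap_toDirLim, dirLimMap_toDirLim, (hex i).apply_apply_eq_zero, map_zero]

theorem dirLimPreservesShortExact : DirLimPreservesShortExact.{r, u, v} R ι :=
  fun _ _ _ _ _ _ _ _ _ _ _ _ _ _ hg hh _ hβ hγ hex =>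
    ⟨dirLimMap_injective hg hβ fun i => (hex i).1, dirLimMap_exact hg hh hγ fun i => (hex i).2.1,
      dirLimMap_surjective hh fun i => (hex i).2.2⟩

theorem dirLimPreservesQuotients : DirLimPreservesQuotients.{r, u, v} R ι := by
  intro A B _ _ _ _ α β g hg _ hβ hinj
  have hq : IsDirectSystem (quotientSystem α β g hg) := hβ.quotientSystem hg
  have hπ : IsSystemHom β (quotientSystem α β g hg) fun i => (LinearMap.range (g i)).mkQ :=
    fun i j h => rfl
  have hex : Function.Exact (dirLimMap α β g hg) (dirLimMap β _ _ hπ) :=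
    dirLimMap_exact hg hπ hq fun i => LinearMap.exact_map_mkQ_range (g i)
  have hsurj : Function.Surjective (dirLimMap β _ _ hπ) :=
    dirLimMap_surjective hπ fun i => Submodule.mkQ_surjective _
  -- By exactness the range of the induced map is the kernel of the projection onto the limit of the
  -- quotients; `e` is the resulting first isomorphism, and `Φ` is its inverse.
  let e := (Submodule.quotEquivOfEq _ _ hex.linearMap_ker_eq.symm).trans
    ((dirLimMap β _ _ hπ).quotKerEquivOfSurjective hsurj)
  refine ⟨hq, dirLimMap_injective hg hβ hinj, e.symm, fun i b => ?_, fun Φ hΦ => ?_⟩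
  · exact (LinearEquiv.symm_apply_eq _).2 (dirLimMap_toDirLim hπ i b).symm
  · refine LinearEquiv.toLinearMap_injective (dirLim_hom_ext fun i c => ?_)
    -- Each class lifts to `B i`, so compatibility with the maps from the `B i` determines `Φ`.
    obtain ⟨b, rfl⟩ := Submodule.Quotient.mk_surjective _ c
    exact (hΦ i b).trans
      ((LinearEquiv.symm_apply_eq _).2 (dirLimMap_toDirLim hπ i b).symm).symm

end directLimits

/-! ### The free modules on finite sets of points. -/

theorem isDirectSystem_inclSystem {M : Type*} (S : Set (Finset M)) :
    IsDirectSystem (inclSystem S) :=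
  ⟨fun _ => Finsupp.lmapDomain_id _ _,
    fun _ _ _ _ _ => (Finsupp.lmapDomain_comp ℤ ℤ _ _).symm⟩

universe u v w

theorem mainTheorem8 {M : Type u} [TopologicalSpace M] [ChartedSpace Plane M]
    [IsManifold (𝓡 2) ∞ M] [DecidableEq M] (hM : IsPlaneOrClosedSurface M)
    (T : HyperbolicSymplecto M) (hT : T.Transverse) (hW : T.WOrientationPreserving) :
    -- all complete sets
    (IsDirectSystem (inclSystem T.completeSets) ∧
      DirectedSystem (fun E : T.completeSets => FreeMod E.1)
        (fun D E h => (inclSystem T.completeSets D E h).toAddMonoidHom) ∧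
      HasDirLim.{0, u, u, w} (inclSystem T.completeSets)) ∧
    -- directed subfamilies
    ∀ S : Set (Finset M), S ⊆ T.completeSets → DirectedOn (· ⊆ ·) S →
      IsDirectSystem (inclSystem S) ∧
      DirectedSystem (fun E : S => FreeMod E.1)
        (fun D E h => (inclSystem S D E h).toAddMonoidHom) ∧
      HasDirLim.{0, u, u, w} (inclSystem S) ∧
      HasDirectedForm (inclSystem S) ∧
      DirLimPreservesShortExact.{0, u, v} ℤ S ∧
      DirLimPreservesQuotients.{0, u, v} ℤ S := by
  refine ⟨⟨isDirectSystem_inclSystem _, (isDirectSystem_inclSystem _).directedSystem,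
    hasDirLim _⟩, fun S _ hS => ?_⟩
  have : IsDirectedOrder S := ⟨directedOn_iff_directed.1 hS⟩
  exact ⟨isDirectSystem_inclSystem S, (isDirectSystem_inclSystem S).directedSystem, hasDirLim _,
    (isDirectSystem_inclSystem S).hasDirectedForm, dirLimPreservesShortExact,
    dirLimPreservesQuotients⟩
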